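/- Let $n\ge 0$ and let $f:\{0,1\}^n\to\{0,1\}$ be an $n$-bit Boolean function. Then $Q_E(f)=n$ if and only if $f$ is isomorphic to $\mathrm{AND}_n$. Here $\mathrm{AND}_n(x)=1$ iff $x_1=\dots=x_n=1$. Two $n$-bit Boolean functions $f,g$ are isomorphic (NPN-equivalent) if they are equal up to permuting the input variables, negating some of the input variables, and possibly negating the output; that is, there are a permutation $\sigma$ of $\{1,\dots,n\}$, bits $a_1,\dots,a_n\in\{0,1\}$ and $c\in\{0,1\}$ such that $f(x)=c\oplus g(a_1\oplus x_{\sigma(1)},\dots,a_n\oplus x_{\sigma(n)})$ for all $x$. A quantum algorithm with $t$ queries works in a finite-dimensional complex Hilbert space with a fixed orthonormal standard basis, each element of which corresponds to exactly one or to none of the input bits. It applies $U_1,Q,U_2,Q,\dots,U_t,Q,U_{t+1}$ (in this order) to a fixed unit starting vector, where the $U_j$ are unitaries that do not depend on the input $x$, and $Q$ multiplies a basis state corresponding to the $i$-th bit by $(-1)^{x_i}$ and fixes a basis state corresponding to no bit. Then it measures in the standard basis and outputs a bit determined by the measured basis state. It computes $f$ exactly if for every $x\in\{0,1\}^n$ the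 output equals $f(x)$ with probability $1$. The exact quantum query complexity $Q_E(f)$ is the least $t$ for which some algorithm with $t$ queries computes $f$ exactly. -/

import Mathlib

/-- `n`-bit (total) Boolean functions. -/
abbrev BoolFun (n : ℕ) : Type := (Fin n → Bool) → Bool

/-- The function `AND_n`: it is `1` exactly on the all-ones input. -/
def andFun (n : ℕ) : BoolFun n := fun x => decide (∀ i, x i = true)

/-- Query-isomorphism (NPN-equivalence): `f` is obtained from `g` by permuting the input variables
(`σ`), negating some of them (those with `a i = true`), and possibly negating the output
(if `c = true`). -/
def QueryIsomorphic {n : ℕ} (f g : BoolFun n) : Prop :=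
  ∃ (σ : Equiv.Perm (Fin n)) (a : Fin n → Bool) (c : Bool),
    ∀ x : Fin n → Bool, f x = xor c (g fun i => xor (a i) (x (σ i)))

/-- A quantum query algorithm on `n` input bits. Its Hilbert space is `State → ℂ` with the standard
inner product, and `State` indexes the standard basis. -/
structure QueryAlgorithm (n : ℕ) where
  /-- labels of the standard basis states -/
  State : Type
  [fintypeState : Fintype State]
  [decEqState : DecidableEq State]
  /-- the input bit to which a basis state corresponds; `none` if it corresponds to no input bit -/
  bit : State → Option (Fin n)
  /-- the fixed starting state, a unit vector -/
  start : State → ℂ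
  start_norm : ∑ s, ‖start s‖ ^ 2 = 1
  /-- the number of applications of the query transformation -/
  queries : ℕ
  /-- the input-independent unitaries; only `U 0, …, U queries` are used -/
  U : ℕ → Matrix.unitaryGroup State ℂ
  /-- the value that is output when the final measurement gives the basis state `s` -/
  output : State → Bool

namespace QueryAlgorithm

attribute [instance] QueryAlgorithm.fintypeState QueryAlgorithm.decEqState

variable {n : ℕ} (A : QueryAlgorithm n)

/-- The eigenvalue of the query transformation at the basis state `s` on input `x`:
`(-1) ^ (x i)` if `s` corresponds to the input bit `i`, and `1` if it corresponds to none. -/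
def phase (x : Fin n → Bool) (s : A.State) : ℂ :=
  match A.bit s with
  | none => 1
  | some i => if x i then -1 else 1

/-- The query transformation on input `x`. -/
def query (x : Fin n → Bool) (ψ : A.State → ℂ) : A.State → ℂ :=
  fun s => A.phase x s * ψ s

/-- The state on input `x` after `k` queries, each followed by the next unitary:
`U k · Q · U (k-1) · Q ⋯ Q · U 0` applied to the starting state. -/
def stateAfter (x : Fin n → Bool) : ℕ → A.State → ℂ
  | 0 => (A.U 0 : Matrix A.State A.State ℂ).mulVec A.start
  | k + 1 => (A.U (k + 1) : Matrix A.State A.State ℂ).mulVec (A.query x (stateAfter x k))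

/-- The probability that the algorithm outputs `b` on input `x`: the final state is measured in the
standard basis. -/
noncomputable def outputProb (x : Fin n → Bool) (b : Bool) : ℝ :=
  ∑ s with A.output s = b, ‖A.stateAfter x A.queries s‖ ^ 2

/-- The algorithm computes `f` exactly: on every input it outputs the correct value with
certainty. -/
def ComputesExactly (f : BoolFun n) : Prop :=
  ∀ x, A.outputProb x (f x) = 1

end QueryAlgorithm

/-- The exact quantum query complexity: the least number of queries of an algorithm that computes
`f` exactly. (An infimum in `ℕ∞`, which is attained whenever it is finite.) -/
noncomputable def exactQuantumQueryComplexity {n : ℕ} (f : BoolFun n) : ℕ∞ :=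
  ⨅ (A : QueryAlgorithm n) (_ : A.ComputesExactly f), (A.queries : ℕ∞)

/-! Both implications reduce to `IsAndType`: being isomorphic to AND means that one value is taken
at a single input `p`. For such `f`, amplitudes after `k` queries have degree at most `k` in the
signs, and those leading to output `f p` vanish off `p`. For `k < n` they are orthogonal to the full
parity, hence vanish at `p` too (`le_queries_of_unique_value`).

For every other `f` on `m + 1` bits, `m` queries suffice. Since families of vectors with equal Gram
matrices differ by a unitary, it is enough to follow Gram matrices
(`GramSolvable.exists_algorithm`). One query determines a bit or the exclusive or of two bits, which
leaves a function of one bit fewer (`GramSolvable.of_restrict`). From four bits on, some such query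
has neither outcome of AND type (`exists_restrict_not_isAndType`). The induction ends at three bits,
where the odd functions need a different first query, in superposition over no bit and all three
bits (`GramSolvable.of_signBranches`). -/

/-! ### Gram matrices of query algorithms -/

/-- The bit of `x` that is read at the label `o`, with `none` read as `false`. -/
def queryBit {n : ℕ} (x : Fin n → Bool) : Option (Fin n) → Bool
  | none => false
  | some i => x i

/-- The eigenvalue of the query transformation on input `x` at a basis state with label `o`. -/
def querySign {n : ℕ} (x : Fin n → Bool) (o : Option (Fin n)) : ℝ :=
  cond (queryBit x o) (-1) 1

/-- `GramSolvable f t G` says that states whose Gram matrix is `G` can be turned, with `t` queries,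
into states that are orthogonal on inputs with different values of `f`. The matrix `M o` is the
Gram matrix of the components of the states on the basis states with label `o`. -/
def GramSolvable {n : ℕ} (f : BoolFun n) : ℕ → Matrix (Fin n → Bool) (Fin n → Bool) ℝ → Prop
  | 0, G => ∀ x y, f x ≠ f y → G x y = 0
  | t + 1, G => ∃ M : Option (Fin n) → Matrix (Fin n → Bool) (Fin n → Bool) ℝ,
      (∀ o, (M o).PosSemidef) ∧ ∑ o, M o = G ∧
        GramSolvable f t (Matrix.of fun x y => ∑ o, querySign x o * querySign y o * M o x y)

/-- The Gram matrix of a family of unit vectors that are all equal. -/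
def onesGram (n : ℕ) : Matrix (Fin n → Bool) (Fin n → Bool) ℝ := Matrix.of fun _ _ => 1

theorem posSemidef_scale {X : Type*} [Fintype X] [DecidableEq X] {M : Matrix X X ℝ}
    (hM : M.PosSemidef) (d : X → ℝ) :
    (Matrix.of fun x y => d x * d y * M x y).PosSemidef := by
  have h := hM.conjTranspose_mul_mul_same (Matrix.diagonal d)
  convert h using 1
  ext x y
  simp [Matrix.diagonal_mul, Matrix.mul_diagonal]
  ring

theorem posSemidef_onesGram (n : ℕ) : (onesGram n).PosSemidef := by
  convert Matrix.posSemidef_vecMulVec_self_star (fun _ : Fin n → Bool => (1 : ℝ)) using 1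
  ext x y
  simp [onesGram, Matrix.vecMulVec]

/-- States that are direct sums of branches, the branch `b` having amplitude `d b x` on input `x`,
can be processed branch by branch. -/
theorem GramSolvable.combine {n : ℕ} {B : Type*} [Fintype B] {f : BoolFun n} {g : B → BoolFun n}
    {d : B → (Fin n → Bool) → ℝ} (hd : ∀ b x, d b x ≠ 0 → f x = g b x) {t : ℕ}
    {G : B → Matrix (Fin n → Bool) (Fin n → Bool) ℝ} (h : ∀ b, GramSolvable (g b) t (G b)) :
    GramSolvable f t (Matrix.of fun x y => ∑ b, d b x * d b y * G b x y) := by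
  induction t generalizing G with
  | zero =>
    intro x y hxy
    refine Finset.sum_eq_zero fun b _ => ?_
    by_cases hx : d b x = 0
    · simp [hx]
    by_cases hy : d b y = 0
    · simp [hy]
    rw [h b x y (by rw [← hd b x hx, ← hd b y hy]; exact hxy), mul_zero]
  | succ t ih =>
    choose M hM hsum hsolv using h
    refine ⟨fun o => ∑ b, Matrix.of fun x y => d b x * d b y * M b o x y, fun o =>
      Matrix.posSemidef_sum _ fun b _ => posSemidef_scale (hM b o) _, ?_, ?_⟩
    · ext x y
      simp only [Matrix.sum_apply, Matrix.of_apply, ← hsum, Finset.mul_sum]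
      exact Finset.sum_comm
    · convert ih hsolv using 1
      ext x y
      simp only [Matrix.sum_apply, Matrix.of_apply, Finset.mul_sum]
      rw [Finset.sum_comm]
      refine Finset.sum_congr rfl fun b _ => Finset.sum_congr rfl fun o _ => ?_
      ring

theorem querySign_removeNth {m : ℕ} (i : Fin (m + 1)) (x : Fin (m + 1) → Bool) (j : Fin m) :
    querySign (i.removeNth x) (some j) = querySign x (some (i.succAbove j)) := rfl

theorem GramSolvable.removeNth {m : ℕ} (i : Fin (m + 1)) {g : BoolFun m} {t : ℕ}
    {G : Matrix (Fin m → Bool) (Fin m → Bool) ℝ} (h : GramSolvable g t G) :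
    GramSolvable (fun x => g (i.removeNth x)) t (G.submatrix i.removeNth i.removeNth) := by
  induction t generalizing G with
  | zero => exact fun x y hxy => h _ _ hxy
  | succ t ih =>
    obtain ⟨M, hM, hsum, hsolv⟩ := h
    -- The ignored bit `i` is never queried: its label gets the zero Gram matrix.
    refine ⟨fun o => o.elim ((M none).submatrix i.removeNth i.removeNth)
      (i.insertNth 0 fun j => (M (some j)).submatrix i.removeNth i.removeNth), ?_, ?_, ?_⟩
    · rintro (_ | k)
      · exact (hM none).submatrix _
      · rcases i.eq_self_or_eq_succAbove k with rfl | ⟨j, rfl⟩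
        · simpa using Matrix.PosSemidef.zero
        · simpa using (hM (some j)).submatrix _
    · ext x y
      simp [← hsum, Fintype.sum_option, Fin.sum_univ_succAbove _ i, Matrix.sum_apply]
    · convert ih hsolv using 1
      ext x y
      simp [Fintype.sum_option, Fin.sum_univ_succAbove _ i, ← querySign_removeNth]
      simp [querySign, queryBit]

/-- A first query in the superposition of labels with probabilities `c`. -/
theorem GramSolvable.first_query {n : ℕ} {B : Type*} [Fintype B] {f : BoolFun n}
    {g : B → BoolFun n} {d : B → (Fin n → Bool) → ℝ} (hd : ∀ b x, d b x ≠ 0 → f x = g b x)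
    (c : Option (Fin n) → ℝ) (hc : ∀ o, 0 ≤ c o) (hsum : ∑ o, c o = 1)
    (hcd : ∀ x y, ∑ o, c o * (querySign x o * querySign y o) = ∑ b, d b x * d b y) {t : ℕ}
    (h : ∀ b, GramSolvable (g b) t (onesGram n)) : GramSolvable f (t + 1) (onesGram n) := by
  refine ⟨fun o => c o • onesGram n, fun o => (posSemidef_onesGram n).smul (hc o), ?_, ?_⟩
  · rw [← Finset.sum_smul, hsum, one_smul]
  · convert GramSolvable.combine hd h using 1
    ext x y
    simp only [Matrix.of_apply, Matrix.smul_apply, onesGram, smul_eq_mul, mul_one]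
    rw [← hcd]
    exact Finset.sum_congr rfl fun o _ => mul_comm _ _

theorem GramSolvable.of_const {n : ℕ} {f : BoolFun n} (h : ∀ x y, f x = f y)
    (G : Matrix (Fin n → Bool) (Fin n → Bool) ℝ) : GramSolvable f 0 G :=
  fun x y hxy => absurd (h x y) hxy

theorem sum_half_labels {n : ℕ} (o o' : Option (Fin n)) (F : Option (Fin n) → ℝ) :
    ∑ k, ((if k = o then 1 / 2 else 0) + (if k = o' then 1 / 2 else 0)) * F k
      = (F o + F o') / 2 := by
  simp only [add_mul, Finset.sum_add_distrib, ite_mul, zero_mul, Finset.sum_ite_eq',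
    Finset.mem_univ, if_true]
  ring

/-- A query in the uniform superposition of the labels `o` and `o'` reveals the exclusive or of the
two bits. -/
theorem GramSolvable.xor_query {n : ℕ} {f : BoolFun n} (o o' : Option (Fin n))
    {g : Bool → BoolFun n} (hg : ∀ x, f x = g (xor (queryBit x o) (queryBit x o')) x) {t : ℕ}
    (h : ∀ b, GramSolvable (g b) t (onesGram n)) : GramSolvable f (t + 1) (onesGram n) := by
  -- The queried state is the sign at `o` times one of two orthogonal vectors, chosen by the
  -- exclusive or; this sign is the branch amplitude. For `o = o'` the weights add up to `1`.
  refine GramSolvable.first_query (g := g)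
    (d := fun b x => if xor (queryBit x o) (queryBit x o') = b then querySign x o else 0) ?_
    (fun k => (if k = o then 1 / 2 else 0) + (if k = o' then 1 / 2 else 0)) ?_ ?_ ?_ h
  · intro b x hx
    rw [hg x]
    by_cases hb : xor (queryBit x o) (queryBit x o') = b
    · rw [hb]
    · simp [hb] at hx
  · intro k
    positivity
  · simpa using sum_half_labels o o' fun _ => 1
  · intro x y
    rw [sum_half_labels o o' fun k => querySign x k * querySign y k]
    simp only [querySign, Fintype.sum_bool]
    cases queryBit x o <;> cases queryBit x o' <;> cases queryBit y o <;> cases queryBit y o' <;>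
      norm_num

theorem GramSolvable.of_xor {n : ℕ} {f : BoolFun n} (c : Bool) (o o' : Option (Fin n))
    (hf : ∀ x, f x = xor c (xor (queryBit x o) (queryBit x o'))) :
    GramSolvable f 1 (onesGram n) :=
  GramSolvable.xor_query o o' (g := fun b _ => xor c b) hf fun _ =>
    GramSolvable.of_const (fun _ _ => rfl) _

/-- The restriction of `f` to the inputs whose bit `i` is `c`, or differs by `c` from one of the
other bits. -/
def BoolFun.restrict {m : ℕ} (f : BoolFun (m + 1)) (i : Fin (m + 1)) (o : Option (Fin m))
    (c : Bool) : BoolFun m :=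
  fun y => f (i.insertNth (xor c (queryBit y o)) y)

theorem GramSolvable.of_restrict {m : ℕ} {f : BoolFun (m + 1)} (i : Fin (m + 1))
    (o : Option (Fin m)) {t : ℕ} (h : ∀ c, GramSolvable (f.restrict i o c) t (onesGram m)) :
    GramSolvable f (t + 1) (onesGram (m + 1)) := by
  refine GramSolvable.xor_query (some i) (o.map i.succAbove)
    (g := fun b x => f.restrict i o b (i.removeNth x)) ?_ fun b => (h b).removeNth i
  intro x
  have hb : queryBit (i.removeNth x) o = queryBit x (o.map i.succAbove) := by
    cases o <;> simp [queryBit, Fin.removeNth]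
  simp only [BoolFun.restrict, hb, Bool.xor_assoc, Bool.xor_self, Bool.xor_false]
  simp [queryBit]

theorem gramSolvable_of_bits : ∀ {n : ℕ} (f : BoolFun n), GramSolvable f n (onesGram n)
  | 0, f => GramSolvable.of_const (fun x y => congrArg f (Subsingleton.elim x y)) _
  | _ + 1, _ => GramSolvable.of_restrict 0 none fun _ => gramSolvable_of_bits _

/-! ### From Gram matrices to algorithms -/

/-- Equal Gram matrices make `u x ↦ w x` a well-defined isometry on the span of `u`, and in finite
dimension it extends to all of `E`. -/
theorem exists_linearIsometry_of_inner_eq {X E : Type*} [Fintype X] [NormedAddCommGroup E]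
    [InnerProductSpace ℂ E] [FiniteDimensional ℂ E] (u w : X → E)
    (h : ∀ x y, inner ℂ (u x) (u y) = inner ℂ (w x) (w y)) :
    ∃ L : E →ₗᵢ[ℂ] E, ∀ x, L (u x) = w x := by
  classical
  let Lu : (X → ℂ) →ₗ[ℂ] E := Fintype.linearCombination ℂ u
  let Lw : (X → ℂ) →ₗ[ℂ] E := Fintype.linearCombination ℂ w
  have hnorm : ∀ c, ‖Lw c‖ = ‖Lu c‖ := by
    intro c
    have hinner : inner ℂ (Lw c) (Lw c) = inner ℂ (Lu c) (Lu c) := by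
      simp only [Lu, Lw, Fintype.linearCombination_apply, sum_inner, inner_sum, inner_smul_left,
        inner_smul_right, h]
    rw [@norm_eq_sqrt_re_inner ℂ, @norm_eq_sqrt_re_inner ℂ, hinner]
  -- `g` chooses coefficients linearly. By `hnorm`, coefficients of the same vector also have the
  -- same image under `Lw`, so the choice is immaterial.
  obtain ⟨g, hg⟩ := Lu.rangeRestrict.exists_rightInverse_of_surjective
    (LinearMap.range_eq_top.2 Lu.surjective_rangeRestrict)
  have hg' : ∀ v : LinearMap.range Lu, Lu (g v) = v := fun v =>
    congrArg Subtype.val (LinearMap.congr_fun hg v)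
  let L : LinearMap.range Lu →ₗᵢ[ℂ] E :=
    { toLinearMap := Lw ∘ₗ g
      norm_map' := fun v => by
        rw [LinearMap.comp_apply, hnorm, hg', Submodule.coe_norm] }
  refine ⟨L.extend, fun x => ?_⟩
  have hLu : Lu (Pi.single x 1) = u x := by simp [Lu]
  have hLw : Lw (Pi.single x 1) = w x := by simp [Lw]
  let v : LinearMap.range Lu := ⟨u x, ⟨Pi.single x 1, hLu⟩⟩
  have hv : L.extend (v : E) = Lw (g v) := LinearIsometry.extend_apply L v
  have hzero : ‖Lw (g v - Pi.single x 1)‖ = 0 := by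
    rw [hnorm, map_sub, hg', hLu]
    simp [v]
  rw [norm_eq_zero, map_sub, sub_eq_zero, hLw] at hzero
  exact hv.trans hzero

theorem exists_unitary_of_gram_eq {X S : Type*} [Fintype X] [Fintype S] [DecidableEq S]
    (u w : X → S → ℝ) (h : ∀ x y, ∑ s, u x s * u y s = ∑ s, w x s * w y s) :
    ∃ U : Matrix.unitaryGroup S ℂ,
      ∀ x, (U : Matrix S S ℂ).mulVec (fun s => (u x s : ℂ)) = fun s => (w x s : ℂ) := by
  have hinner : ∀ a b : S → ℝ, inner ℂ (WithLp.toLp 2 fun s => (a s : ℂ))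
      (WithLp.toLp 2 fun s => (b s : ℂ) : EuclideanSpace ℂ S) = ((∑ s, a s * b s : ℝ) : ℂ) := by
    intro a b
    simp [PiLp.inner_apply, mul_comm]
  obtain ⟨L, hL⟩ := exists_linearIsometry_of_inner_eq
    (fun x => (WithLp.toLp 2 fun s => (u x s : ℂ) : EuclideanSpace ℂ S))
    (fun x => WithLp.toLp 2 fun s => (w x s : ℂ)) fun x y => by rw [hinner, hinner, h]
  let T : EuclideanSpace ℂ S →L[ℂ] EuclideanSpace ℂ S := L.toContinuousLinearMap
  have hT : star T * T = 1 := (ContinuousLinearMap.norm_map_iff_adjoint_comp_self T).1 L.norm_map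
  obtain ⟨M, hM⟩ := EquivLike.surjective (Matrix.toEuclideanCLM (n := S) (𝕜 := ℂ)) T
  refine ⟨⟨M, ?_⟩, fun x => ?_⟩
  · rw [Matrix.mem_unitaryGroup_iff']
    apply EquivLike.injective (Matrix.toEuclideanCLM (n := S) (𝕜 := ℂ))
    rw [map_mul, map_star, hM, hT, map_one]
  · have hx : Matrix.toEuclideanCLM (n := S) (𝕜 := ℂ) M (WithLp.toLp 2 fun s => (u x s : ℂ))
        = WithLp.toLp 2 fun s => (w x s : ℂ) := by
      rw [hM]
      exact hL x
    simpa using congrArg WithLp.ofLp hx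

theorem Matrix.PosSemidef.exists_gram {X : Type*} [Fintype X] [DecidableEq X] {G : Matrix X X ℝ}
    (hG : G.PosSemidef) : ∃ v : X → X → ℝ, ∀ x y, ∑ z, v x z * v y z = G x y := by
  open scoped MatrixOrder in
  obtain ⟨B, hB⟩ := CStarAlgebra.nonneg_iff_eq_star_mul_self.1 hG.nonneg
  refine ⟨fun x z => B z x, fun x y => ?_⟩
  rw [hB]
  simp [Matrix.mul_apply]

namespace QueryAlgorithm

variable {n : ℕ}

theorem sum_norm_sq_mulVec {S : Type*} [Fintype S] [DecidableEq S] (U : Matrix.unitaryGroup S ℂ)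
    (v : S → ℂ) : ∑ s, ‖(U : Matrix S S ℂ).mulVec v s‖ ^ 2 = ∑ s, ‖v s‖ ^ 2 := by
  have hdot : ∀ w : S → ℂ, star w ⬝ᵥ w = ((∑ s, ‖w s‖ ^ 2 : ℝ) : ℂ) := by
    intro w
    simp [dotProduct, Complex.conj_mul']
  have hU : star (U : Matrix S S ℂ) * U = 1 := Matrix.mem_unitaryGroup_iff'.1 U.2
  apply Complex.ofReal_injective
  rw [← hdot, ← hdot, Matrix.star_mulVec, Matrix.dotProduct_mulVec, Matrix.vecMul_vecMul,
    ← Matrix.star_eq_conjTranspose, hU, Matrix.vecMul_one]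

theorem phase_eq (A : QueryAlgorithm n) (x : Fin n → Bool) (s : A.State) :
    A.phase x s = (querySign x (A.bit s) : ℂ) := by
  unfold phase
  cases A.bit s with
  | none => simp [querySign, queryBit]
  | some i => cases h : x i <;> simp [querySign, queryBit, h]

theorem sum_norm_sq_stateAfter (A : QueryAlgorithm n) (x : Fin n → Bool) (k : ℕ) :
    ∑ s, ‖A.stateAfter x k s‖ ^ 2 = 1 := by
  induction k with
  | zero => rw [stateAfter, sum_norm_sq_mulVec, A.start_norm]
  | succ k ih =>
    rw [stateAfter, sum_norm_sq_mulVec, ← ih]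
    refine Finset.sum_congr rfl fun s _ => ?_
    have : ‖A.phase x s‖ = 1 := by
      rw [phase_eq, querySign]
      cases queryBit x (A.bit s) <;> simp
    rw [query, norm_mul, this, one_mul]

theorem outputProb_eq_one_iff (A : QueryAlgorithm n) (x : Fin n → Bool) (b : Bool) :
    A.outputProb x b = 1 ↔ ∀ s, A.output s ≠ b → A.stateAfter x A.queries s = 0 := by
  have hsplit := Finset.sum_filter_add_sum_filter_not Finset.univ (fun s => A.output s = b)
    fun s => ‖A.stateAfter x A.queries s‖ ^ 2
  rw [sum_norm_sq_stateAfter] at hsplit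
  have hzero : A.outputProb x b = 1 ↔
      ∑ s with ¬A.output s = b, ‖A.stateAfter x A.queries s‖ ^ 2 = 0 := by
    unfold outputProb
    constructor <;> intro h <;> linarith
  rw [hzero, Finset.sum_eq_zero_iff_of_nonneg fun s _ => sq_nonneg _]
  simp

end QueryAlgorithm

/-- The basis states of the algorithm that is built from a solution in Gram matrices: a query
label, a register for the output, and a work register. -/
abbrev GramState (n : ℕ) : Type := Option (Fin n) × Bool × (Fin n → Bool)

/-- Each Gram matrix `M o` is realised by vectors in the block of label `o`. Consecutive states only
need matching Gram matrices, so unitaries can be supplied afterwards. -/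
theorem GramSolvable.exists_states {n : ℕ} {f : BoolFun n} {t : ℕ}
    {G : Matrix (Fin n → Bool) (Fin n → Bool) ℝ} (h : GramSolvable f t G) (hG : G.PosSemidef) :
    ∃ ψ : ℕ → (Fin n → Bool) → GramState n → ℝ,
      (∀ x y, ∑ s, ψ 0 x s * ψ 0 y s = G x y) ∧
      (∀ k < t, ∀ x y, ∑ s, ψ (k + 1) x s * ψ (k + 1) y s =
        ∑ s, (querySign x s.1 * ψ k x s) * (querySign y s.1 * ψ k y s)) ∧
      ∀ x s, s.2.1 ≠ f x → ψ t x s = 0 := by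
  induction t generalizing G with
  | zero =>
    obtain ⟨v, hv⟩ := hG.exists_gram
    -- Writing `f x` into the output register makes inputs with different values orthogonal; there
    -- `G` is zero already, so the Gram matrix is unchanged.
    refine ⟨fun _ x s => if s.1 = none ∧ s.2.1 = f x then v x s.2.2 else 0, fun x y => ?_,
      fun k hk => absurd hk (Nat.not_lt_zero k), fun x s hs => by simp [hs]⟩
    have hfg : ∀ o b z, (if o = (none : Option (Fin n)) ∧ b = f x then v x z else 0) *
        (if o = (none : Option (Fin n)) ∧ b = f y then v y z else 0) =
        if o = none then if b = f x then if f x = f y then v x z * v y z else 0 else 0 else 0 := by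
      intro o b z
      grind
    simp only [Fintype.sum_prod_type, hfg]
    by_cases hxy : f x = f y
    · simp [hxy, hv]
    · simp [hxy, h x y hxy]
  | succ t ih =>
    obtain ⟨M, hM, hsum, hsolv⟩ := h
    choose v hv using fun o => (hM o).exists_gram
    obtain ⟨ψ, h0, hstep, hend⟩ := ih hsolv (by
      have : (Matrix.of fun x y => ∑ o, querySign x o * querySign y o * M o x y) =
          ∑ o, Matrix.of fun x y => querySign x o * querySign y o * M o x y := by
        ext x y
        simp [Matrix.sum_apply]
      rw [this]
      exact Matrix.posSemidef_sum _ fun o _ => posSemidef_scale (hM o) fun x => querySign x o)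
    let φ : (Fin n → Bool) → GramState n → ℝ :=
      fun x s => if s.2.1 = false then v s.1 x s.2.2 else 0
    refine ⟨fun k => k.casesOn φ ψ, fun x y => ?_, fun k hk => ?_, hend⟩
    · simp [φ, Fintype.sum_prod_type, hv, ← hsum, Matrix.sum_apply]
    · cases k with
      | zero =>
        intro x y
        refine (h0 x y).trans ?_
        simp [φ, Fintype.sum_prod_type, ← hv, Finset.mul_sum, mul_mul_mul_comm]
      | succ k => exact hstep k (by omega)

theorem GramSolvable.exists_algorithm {n : ℕ} {f : BoolFun n} {t : ℕ}
    (h : GramSolvable f t (onesGram n)) :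
    ∃ A : QueryAlgorithm n, A.queries = t ∧ A.ComputesExactly f := by
  obtain ⟨ψ, h0, hstep, hend⟩ := h.exists_states (posSemidef_onesGram n)
  let s₀ : GramState n := (none, false, fun _ => false)
  obtain ⟨U₀, hU₀⟩ := exists_unitary_of_gram_eq (fun _ => Pi.single s₀ 1) (ψ 0) (by
    intro x y
    rw [h0]
    simp [onesGram, Pi.single_apply])
  have hex : ∀ k, ∃ U : Matrix.unitaryGroup (GramState n) ℂ, k < t → ∀ x,
      (U : Matrix (GramState n) (GramState n) ℂ).mulVec
        (fun s => ((querySign x s.1 * ψ k x s : ℝ) : ℂ)) = fun s => (ψ (k + 1) x s : ℂ) := by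
    intro k
    by_cases hk : k < t
    · obtain ⟨U, hU⟩ := exists_unitary_of_gram_eq (fun x s => querySign x s.1 * ψ k x s)
        (ψ (k + 1)) fun x y => (hstep k hk x y).symm
      exact ⟨U, fun _ => hU⟩
    -- Unitaries past the last query are never applied.
    · exact ⟨1, fun hk' => absurd hk' hk⟩
  choose U hU using hex
  let A : QueryAlgorithm n :=
    { State := GramState n
      bit := fun s => s.1
      start := fun s => ((Pi.single s₀ 1 : GramState n → ℝ) s : ℂ)
      start_norm := by simp [Pi.single_apply, apply_ite]
      queries := t
      U := fun k => k.casesOn U₀ U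
      output := fun s => s.2.1 }
  have hstate : ∀ x, ∀ k ≤ t, A.stateAfter x k = fun s => (ψ k x s : ℂ) := by
    intro x k
    induction k with
    | zero => exact fun _ => hU₀ x
    | succ k ih =>
      intro hk
      rw [← hU k (by omega) x, QueryAlgorithm.stateAfter, ih (by omega)]
      congr 1
      ext s
      rw [QueryAlgorithm.query, A.phase_eq]
      push_cast
      rfl
  refine ⟨A, rfl, fun x => (A.outputProb_eq_one_iff x (f x)).2 fun s hs => ?_⟩
  rw [hstate x t le_rfl]
  exact (congrArg Complex.ofReal (hend x s hs)).trans Complex.ofReal_zero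

/-! ### The lower bound -/

/-- The Walsh character of the set `S` of input bits. -/
noncomputable def walsh {n : ℕ} (S : Finset (Fin n)) (x : Fin n → Bool) : ℂ :=
  ∏ i ∈ S, if x i then -1 else 1

theorem sum_walsh {n : ℕ} {S : Finset (Fin n)} (hS : S.Nonempty) :
    ∑ x : Fin n → Bool, walsh S x = 0 := by
  have h : ∀ x : Fin n → Bool,
      walsh S x = ∏ i, if i ∈ S then (if x i then -1 else 1 : ℂ) else 1 := by
    intro x
    rw [Finset.prod_ite_mem, Finset.univ_inter]
    rfl
  simp_rw [h]
  obtain ⟨i, hi⟩ := hS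
  have := Finset.prod_univ_sum (fun _ : Fin n => (Finset.univ : Finset Bool))
    fun i b => if i ∈ S then (if b then -1 else 1 : ℂ) else 1
  rw [Fintype.piFinset_univ] at this
  rw [← this]
  exact Finset.prod_eq_zero (Finset.mem_univ i) (by simp [hi])

/-- Signs square to `1`, so multiplication by the sign of bit `i` toggles the membership of `i` in
`S`. -/
theorem exists_walsh_mul {n : ℕ} (S : Finset (Fin n)) (i : Fin n) :
    ∃ S' : Finset (Fin n), S.card ≤ S'.card + 1 ∧
      ∀ x, walsh S x * (if x i then -1 else 1) = walsh S' x := by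
  by_cases hi : i ∈ S
  · refine ⟨S.erase i, by rw [Finset.card_erase_add_one hi], fun x => ?_⟩
    rw [walsh, ← Finset.prod_erase_mul S _ hi, mul_assoc]
    cases x i <;> simp [walsh]
  · refine ⟨insert i S, by rw [Finset.card_insert_of_notMem hi]; omega, fun x => ?_⟩
    rw [walsh, walsh, Finset.prod_insert hi, mul_comm]

namespace QueryAlgorithm

variable {n : ℕ}

/-- After `k` queries the amplitudes are polynomials of degree at most `k` in the input signs. -/
theorem sum_walsh_mul_stateAfter (A : QueryAlgorithm n) (k : ℕ) (S : Finset (Fin n))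
    (hS : k < S.card) (s : A.State) : ∑ x, walsh S x * A.stateAfter x k s = 0 := by
  induction k generalizing S s with
  | zero =>
    simp only [stateAfter]
    rw [← Finset.sum_mul, sum_walsh (Finset.card_pos.1 hS), zero_mul]
  | succ k ih =>
    have hphase : ∀ r, ∑ x, walsh S x * (A.phase x r * A.stateAfter x k r) = 0 := by
      intro r
      cases hr : A.bit r with
      | none => simpa [phase, hr] using ih S (by omega) r
      | some i =>
        obtain ⟨S', hcard, hS'⟩ := exists_walsh_mul S i
        have := ih S' (by omega) r
        simp only [← hS', mul_assoc] at this
        simpa only [phase, hr] using this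
    simp only [stateAfter, Matrix.mulVec, dotProduct, query, Finset.mul_sum]
    rw [Finset.sum_comm]
    refine Finset.sum_eq_zero fun r _ => ?_
    rw [← mul_zero ((A.U (k + 1) : Matrix A.State A.State ℂ) s r), ← hphase r, Finset.mul_sum]
    exact Finset.sum_congr rfl fun x _ => mul_left_comm _ _ _

/-- An algorithm that distinguishes one input from all the others queries at least `n` times. -/
theorem le_queries_of_unique_value (A : QueryAlgorithm n) {f : BoolFun n}
    (hA : A.ComputesExactly f) (p : Fin n → Bool) (hp : ∀ x, x ≠ p → f x ≠ f p) :
    n ≤ A.queries := by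
  by_contra! hlt
  have hzero : ∀ s, A.output s = f p → A.stateAfter p A.queries s = 0 := by
    intro s hs
    have hsum := A.sum_walsh_mul_stateAfter A.queries Finset.univ (by simpa using hlt) s
    rw [Finset.sum_eq_single p] at hsum
    · refine (mul_eq_zero.1 hsum).resolve_left (Finset.prod_ne_zero_iff.2 fun i _ => ?_)
      split_ifs <;> simp
    · intro x _ hx
      rw [(A.outputProb_eq_one_iff x (f x)).1 (hA x) s (by rw [hs]; exact (hp x hx).symm), mul_zero]
    · simp
  have h1 := hA p
  rw [outputProb, Finset.sum_eq_zero] at h1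
  · exact zero_ne_one h1
  · intro s hs
    rw [hzero s (Finset.mem_filter.1 hs).2]
    simp

end QueryAlgorithm

/-! ### Functions isomorphic to `AND` -/

/-- `f` takes one of its values at exactly one input. -/
def IsAndType {n : ℕ} (f : BoolFun n) : Prop :=
  ∃ (p : Fin n → Bool) (v : Bool), ∀ x, f x = v ↔ x = p

theorem queryIsomorphic_andFun_iff {n : ℕ} {f : BoolFun n} :
    QueryIsomorphic f (andFun n) ↔ IsAndType f := by
  constructor
  · rintro ⟨σ, a, c, h⟩
    -- The exceptional input is the solution of `xor (a i) (x (σ i)) = true` for all `i`.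
    refine ⟨fun i => !a (σ.symm i), !c, fun x => ?_⟩
    have hx : andFun n (fun i => xor (a i) (x (σ i))) = true ↔ x = fun i => !a (σ.symm i) := by
      rw [andFun, decide_eq_true_iff, funext_iff,
        ← σ.forall_congr_right (q := fun i => x i = !a (σ.symm i))]
      refine forall_congr' fun i => ?_
      rw [σ.symm_apply_apply]
      cases a i <;> cases x (σ i) <;> simp
    rw [h, ← hx]
    cases c <;> cases andFun n (fun i => xor (a i) (x (σ i))) <;> simp
  · rintro ⟨p, v, h⟩
    refine ⟨1, fun i => !p i, !v, fun x => ?_⟩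
    have hx : andFun n (fun i => xor (!p i) (x i)) = true ↔ f x = v := by
      rw [andFun, decide_eq_true_iff, h, funext_iff]
      refine forall_congr' fun i => ?_
      cases p i <;> cases x i <;> simp
    simp only [Equiv.Perm.one_apply]
    generalize andFun n (fun i => xor (!p i) (x i)) = b at hx ⊢
    generalize f x = w at hx ⊢
    clear h
    revert v b w
    decide

/-! ### Functions of two and three bits -/

/-- The two-bit function with the given values at `00`, `01`, `10`, `11`. -/
def truthTable₂ (a b c d : Bool) (x y : Bool) : Bool :=
  cond x (cond y d c) (cond y b a)

theorem exists_truthTable₂ (f : BoolFun 2) :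
    ∃ a b c d, ∀ x, f x = truthTable₂ a b c d (x 0) (x 1) := by
  refine ⟨f ![false, false], f ![false, true], f ![true, false], f ![true, true], fun x => ?_⟩
  have hx : x = ![x 0, x 1] := by
    ext i
    fin_cases i <;> rfl
  rw [hx]
  simp only [Matrix.cons_val_zero, Matrix.cons_val_one]
  cases x 0 <;> cases x 1 <;> rfl

/-- The exclusive or of all values of a two-bit function. -/
def parity₂ (f : BoolFun 2) : Bool :=
  xor (xor (f ![false, false]) (f ![false, true])) (xor (f ![true, false]) (f ![true, true]))

/-- Even parity kills the product term of the polynomial over the two-element field, so `f` is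
affine. -/
theorem gramSolvable_of_parity₂ {f : BoolFun 2} (h : parity₂ f = false) :
    GramSolvable f 1 (onesGram 2) := by
  obtain ⟨a, b, c, d, hf⟩ := exists_truthTable₂ f
  have key : ∀ a b c d : Bool, xor (xor a b) (xor c d) = false →
      ∃ (k : Bool) (o o' : Option (Fin 2)), ∀ x y : Bool,
        truthTable₂ a b c d x y = xor k (xor (queryBit ![x, y] o) (queryBit ![x, y] o')) := by
    decide
  obtain ⟨k, o, o', hk⟩ := key a b c d (by simpa [parity₂, hf, truthTable₂] using h)
  refine GramSolvable.of_xor k o o' fun x => ?_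
  have hx : x = ![x 0, x 1] := by
    ext i
    fin_cases i <;> rfl
  rw [hf, hk, ← hx]

/-- With odd parity, one of the four values differs from the other three. -/
theorem parity₂_of_not_isAndType {f : BoolFun 2} (h : ¬IsAndType f) : parity₂ f = false := by
  obtain ⟨a, b, c, d, hf⟩ := exists_truthTable₂ f
  have key : ∀ a b c d : Bool, xor (xor a b) (xor c d) = true →
      ∃ p q v : Bool, ∀ x y : Bool, truthTable₂ a b c d x y = v ↔ x = p ∧ y = q := by
    decide
  by_contra hpar
  obtain ⟨p, q, v, hv⟩ := key a b c d (by simpa [parity₂, hf, truthTable₂] using hpar)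
  refine h ⟨![p, q], v, fun x => ?_⟩
  rw [hf, hv, funext_iff, Fin.forall_fin_two]
  rfl

/-- The three-bit function with the given values at `000`, `001`, …, `111`. -/
def truthTable₃ (a b c d e f g h : Bool) (x y z : Bool) : Bool :=
  cond x (truthTable₂ e f g h y z) (truthTable₂ a b c d y z)

theorem eta_three (x : Fin 3 → Bool) : x = ![x 0, x 1, x 2] := by
  ext i
  fin_cases i <;> rfl

theorem exists_truthTable₃ (f : BoolFun 3) :
    ∃ a b c d e g h k, ∀ x, f x = truthTable₃ a b c d e g h k (x 0) (x 1) (x 2) := by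
  refine ⟨f ![false, false, false], f ![false, false, true], f ![false, true, false],
    f ![false, true, true], f ![true, false, false], f ![true, false, true], f ![true, true, false],
    f ![true, true, true], fun x => ?_⟩
  conv_lhs => rw [eta_three x]
  cases x 0 <;> cases x 1 <;> cases x 2 <;> rfl

/-- Conjunction over both truth values, as a Boolean. -/
def allBool (P : Bool → Bool) : Bool := P false && P true

/-- Disjunction over both truth values, as a Boolean. -/
def anyBool (P : Bool → Bool) : Bool := P false || P true

theorem allBool_eq_true {P : Bool → Bool} : allBool P = true ↔ ∀ b, P b = true := by
  simp [allBool, Bool.forall_bool]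

theorem anyBool_eq_true {P : Bool → Bool} : anyBool P = true ↔ ∃ b, P b = true := by
  simp [anyBool, Bool.exists_bool]

/-- Test whether `F` takes one of its values at exactly one input. -/
def testAndType (F : Bool → Bool → Bool → Bool) : Bool :=
  anyBool fun p => anyBool fun q => anyBool fun r => anyBool fun v =>
    allBool fun x => allBool fun y => allBool fun z =>
      (F x y z == v) == (x == p && (y == q && z == r))

/-- Test whether, on the inputs that satisfy `P`, the function `F` agrees with an affine function
of at most two of the bits. -/
def testXorOn (F P : Bool → Bool → Bool → Bool) : Bool :=
  anyBool fun k => anyBool fun a => anyBool fun b => anyBool fun c =>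
    !(a && (b && c)) && allBool fun x => allBool fun y => allBool fun z =>
      !P x y z || F x y z == xor k (xor (a && x) (xor (b && y) (c && z)))

/-- The coefficients of the sum of the four signs `1, s, t, u` and of their pairwise differences. -/
noncomputable def signBranch (s t u : ℝ) : Fin 7 → ℝ :=
  ![1 + s + t + u, 1 - s, 1 - t, 1 - u, s - t, s - u, t - u]

/-- The inputs at which the forms `signBranch` of their signs do not vanish. -/
def signBranchSupport (i : Fin 7) (x y z : Bool) : Bool :=
  match i with
  | 0 => !(cond x (xor y z) (y && z))
  | 1 => x
  | 2 => y
  | 3 => z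
  | 4 => xor x y
  | 5 => xor x z
  | 6 => xor y z

theorem signBranch_eq_zero : ∀ (i : Fin 7) (x y z : Bool), signBranchSupport i x y z = false →
    signBranch (cond x (-1) 1) (cond y (-1) 1) (cond z (-1) 1) i = 0 := by
  intro i x y z
  fin_cases i <;> cases x <;> cases y <;> cases z <;> simp [signBranch, signBranchSupport]

/-- Even parity means degree at most two over the two-element field. Fixing `x` leaves the
coefficient of `yz` as parity; fixing `xor x y` leaves the sum of those of `yz` and `xz`. If no
quadratic coefficient is zero, this sum is. -/
theorem even_three_bit_cases : ∀ a b c d e g h k : Bool,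
    xor (xor (xor a b) (xor c d)) (xor (xor e g) (xor h k)) = false →
    ∃ (i : Fin 3) (o : Option (Fin 2)), ∀ t : Bool, parity₂ (BoolFun.restrict (m := 2)
      (fun x => truthTable₃ a b c d e g h k (x 0) (x 1) (x 2)) i o t) = false := by
  decide +kernel

/-- An odd function is the indicator of a point plus an affine `ℓ`. The coordinates of the point are
the parities of the function on the faces where a bit is `1`; the shift moves it to the origin. The
last six supports avoid the origin and fix a bit or an exclusive or, which eliminates one variable
from `ℓ`. On support `0` the indicator equals `1 + x + y + z`, so all three variables survive only
if `ℓ` is constant, which is AND type. -/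
theorem odd_three_bit_cases : ∀ a b c d e g h k : Bool,
    xor (xor (xor a b) (xor c d)) (xor (xor e g) (xor h k)) = true →
    testAndType (truthTable₃ a b c d e g h k) = true ∨
    ∀ i, testXorOn (truthTable₃ a b c d e g h k) (fun x y z =>
      signBranchSupport i (xor (xor (xor e g) (xor h k)) x) (xor (xor (xor c d) (xor h k)) y)
        (xor (xor (xor b d) (xor g k)) z)) = true := by
  decide +kernel

theorem GramSolvable.of_testXorOn {f : BoolFun 3} {F P : Bool → Bool → Bool → Bool}
    (hf : ∀ x, f x = F (x 0) (x 1) (x 2)) (h : testXorOn F P = true) :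
    ∃ g : BoolFun 3, (∀ x, P (x 0) (x 1) (x 2) = true → f x = g x) ∧
      GramSolvable g 1 (onesGram 3) := by
  simp only [testXorOn, anyBool_eq_true, allBool_eq_true, Bool.and_eq_true] at h
  obtain ⟨k, a, b, c, habc, h⟩ := h
  refine ⟨fun x => xor k (xor (a && x 0) (xor (b && x 1) (c && x 2))), fun x hx => ?_, ?_⟩
  · have := h (x 0) (x 1) (x 2)
    rw [hx] at this
    rw [hf]
    simpa using this
  · have key : ∀ a b c : Bool, (!(a && (b && c))) = true → ∃ o o' : Option (Fin 3),
        ∀ x y z : Bool, xor (a && x) (xor (b && y) (c && z))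
          = xor (queryBit ![x, y, z] o) (queryBit ![x, y, z] o') := by
      decide
    obtain ⟨o, o', ho⟩ := key a b c habc
    refine GramSolvable.of_xor k o o' fun x => ?_
    rw [ho, ← eta_three x]

/-- The sum of four signs and their pairwise differences have, up to a factor, the same Gram matrix
as the four signs. So a query with four equal amplitudes can be followed by the branches
`signBranch`. -/
theorem GramSolvable.of_signBranches {f : BoolFun 3} {F : Bool → Bool → Bool → Bool}
    (hf : ∀ x, f x = F (x 0) (x 1) (x 2)) {p q r : Bool}
    (h : ∀ i, testXorOn F (fun x y z =>
      signBranchSupport i (xor p x) (xor q y) (xor r z)) = true) :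
    GramSolvable f 2 (onesGram 3) := by
  choose g hg hs using fun i => GramSolvable.of_testXorOn hf (h i)
  -- The products of the seven forms sum to four times the inner product of the sign vectors.
  -- Division by `4` turns this into the weights `1 / 4`.
  refine GramSolvable.first_query (g := g) (d := fun i x => signBranch (cond (xor p (x 0)) (-1) 1)
    (cond (xor q (x 1)) (-1) 1) (cond (xor r (x 2)) (-1) 1) i / 4) ?_ (fun _ => 1 / 4) (by norm_num)
    (by simp) ?_ hs
  · intro i x hx
    apply hg
    by_contra hsupp
    exact hx (by rw [signBranch_eq_zero i _ _ _ (Bool.eq_false_of_not_eq_true hsupp), zero_div])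
  · intro x y
    -- A shift changes both signs in a product, so it leaves the Gram matrix alone.
    have hb : ∀ s u v : Bool, (cond u (-1) 1 * cond v (-1) 1 : ℝ)
        = cond (xor s u) (-1) 1 * cond (xor s v) (-1) 1 := by
      rintro (_ | _) (_ | _) (_ | _) <;> simp
    simp only [Fintype.sum_option, Fin.sum_univ_three, querySign, queryBit, hb p (x 0) (y 0),
      hb q (x 1) (y 1), hb r (x 2) (y 2), cond_false, Fin.sum_univ_seven, signBranch,
      Matrix.cons_val]
    ring

theorem gramSolvable_three {f : BoolFun 3} (h : ¬IsAndType f) : GramSolvable f 2 (onesGram 3) := by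
  obtain ⟨a, b, c, d, e, g, u, w, hf⟩ := exists_truthTable₃ f
  cases hpar : xor (xor (xor a b) (xor c d)) (xor (xor e g) (xor u w)) with
  | false =>
    obtain ⟨i, o, hio⟩ := even_three_bit_cases a b c d e g u w hpar
    rw [← funext hf] at hio
    exact GramSolvable.of_restrict i o fun t => gramSolvable_of_parity₂ (hio t)
  | true =>
    rcases odd_three_bit_cases a b c d e g u w hpar with hand | hsigns
    · simp only [testAndType, anyBool_eq_true, allBool_eq_true] at hand
      obtain ⟨p, q, r, v, hv⟩ := hand
      refine absurd ⟨![p, q, r], v, fun x => ?_⟩ h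
      have hx := hv (x 0) (x 1) (x 2)
      rw [beq_iff_eq, Bool.eq_iff_iff] at hx
      simp only [Bool.and_eq_true, beq_iff_eq] at hx
      rw [hf, hx, funext_iff, Fin.forall_fin_succ, Fin.forall_fin_two]
      rfl
    · exact GramSolvable.of_signBranches hf hsigns

/-! ### Functions of four or more bits -/

theorem IsAndType.of_restrict {m : ℕ} {f : BoolFun (m + 1)} {i : Fin (m + 1)} {o : Option (Fin m)}
    {c : Bool} (h : IsAndType (f.restrict i o c)) :
    ∃ (p : Fin (m + 1) → Bool) (v : Bool),
      xor (p i) (queryBit p (o.map i.succAbove)) = c ∧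
      ∀ x, xor (x i) (queryBit x (o.map i.succAbove)) = c → (f x = v ↔ x = p) := by
  obtain ⟨q, v, hq⟩ := h
  have hbit : ∀ x : Fin (m + 1) → Bool,
      queryBit (i.removeNth x) o = queryBit x (o.map i.succAbove) := by
    intro x
    cases o <;> rfl
  have hins : ∀ x : Fin (m + 1) → Bool, xor (x i) (queryBit x (o.map i.succAbove)) = c →
      x = i.insertNth (xor c (queryBit (i.removeNth x) o)) (i.removeNth x) := by
    intro x hx
    rw [hbit, ← hx, Bool.xor_assoc, Bool.xor_self, Bool.xor_false, Fin.insertNth_self_removeNth]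
  refine ⟨i.insertNth (xor c (queryBit q o)) q, v, ?_, fun x hx => ?_⟩
  · rw [← hbit]
    simp
  · constructor
    · intro hf
      rw [hins x hx] at hf
      have hxq := (hq _).1 hf
      rw [hins x hx, hxq]
    · rintro rfl
      exact (hq q).2 rfl

/-- Already three of the four distinct points cannot all lie in `{a, b}`. -/
theorem exists_ne_of_two_free_bits {n : ℕ} (y : Bool → Bool → Fin n → Bool) {k l : Fin n}
    (hk : ∀ u w, y u w k = u) (hl : ∀ u w, y u w l = w) (a b : Fin n → Bool) :
    ∃ u w, y u w ≠ a ∧ y u w ≠ b := by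
  have hinj : ∀ u w u' w', y u w = y u' w' → u = u' ∧ w = w' := by
    intro u w u' w' h
    exact ⟨by rw [← hk u w, h, hk], by rw [← hl u w, h, hl]⟩
  by_contra! h
  have h₁₂ : y false false ≠ y false true := fun e => Bool.false_ne_true (hinj _ _ _ _ e).2
  have h₁₃ : y false false ≠ y true false := fun e => Bool.false_ne_true (hinj _ _ _ _ e).1
  have h₂₃ : y false true ≠ y true false := fun e => Bool.false_ne_true (hinj _ _ _ _ e).1
  rcases or_iff_not_imp_left.2 (h false false) with e₁ | e₁ <;>
    rcases or_iff_not_imp_left.2 (h false true) with e₂ | e₂ <;>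
    rcases or_iff_not_imp_left.2 (h true false) with e₃ | e₃ <;>
    first
    | exact h₁₂ (e₁.trans e₂.symm)
    | exact h₁₃ (e₁.trans e₃.symm)
    | exact h₂₃ (e₂.trans e₃.symm)

/-- Otherwise each bit `i` has a half cube `x i = b i` with a unique exceptional point `s i`, and
each pair of bits a parity class with one. All exceptional values agree, and the `s i` are distinct,
so `s i` agrees with `b` at bit `i` only. Four distinct bits then put two such points into either
parity class. -/
theorem exists_restrict_not_isAndType {m : ℕ} (hm : 3 ≤ m) {f : BoolFun (m + 1)}
    (hf : ¬IsAndType f) : ∃ i o, ∀ c, ¬IsAndType (f.restrict i o c) := by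
  by_contra! hall
  have hone : ∀ i, ∃ (b : Bool) (s : Fin (m + 1) → Bool) (v : Bool), s i = b ∧
      ∀ x, x i = b → (f x = v ↔ x = s) := by
    intro i
    obtain ⟨c, hc⟩ := hall i none
    obtain ⟨p, v, hp, hv⟩ := hc.of_restrict
    exact ⟨c, p, v, by simpa [queryBit] using hp, fun x hx => hv x (by simpa [queryBit] using hx)⟩
  have htwo : ∀ i j, i ≠ j → ∃ (c : Bool) (p : Fin (m + 1) → Bool) (v : Bool),
      xor (p i) (p j) = c ∧ ∀ x, xor (x i) (x j) = c → (f x = v ↔ x = p) := by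
    intro i j hij
    obtain ⟨j', rfl⟩ := Fin.exists_succAbove_eq hij.symm
    obtain ⟨c, hc⟩ := hall i (some j')
    obtain ⟨p, v, hp, hv⟩ := hc.of_restrict
    exact ⟨c, p, v, hp, hv⟩
  have hfree : ∀ i j : Fin (m + 1), ∃ k l, k ≠ l ∧ k ≠ i ∧ k ≠ j ∧ l ≠ i ∧ l ≠ j := by
    intro i j
    have hcard : 1 < (Finset.univ \ {i, j} : Finset (Fin (m + 1))).card := by
      have h1 := Finset.le_card_sdiff ({i, j} : Finset (Fin (m + 1))) Finset.univ
      have h2 : ({i, j} : Finset (Fin (m + 1))).card ≤ 2 := Finset.card_le_two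
      rw [Finset.card_univ, Fintype.card_fin] at h1
      omega
    obtain ⟨k, hk, l, hl, hkl⟩ := Finset.one_lt_card.1 hcard
    simp only [Finset.mem_sdiff, Finset.mem_univ, Finset.mem_insert, Finset.mem_singleton,
      true_and, not_or] at hk hl
    exact ⟨k, l, hkl, hk.1, hk.2, hl.1, hl.2⟩
  choose b s v hb hs using hone
  have hv : ∀ i j, v i = v j := by
    intro i j
    by_contra hij
    obtain ⟨k, l, hkl, hki, hkj, hli, hlj⟩ := hfree i j
    -- A point in both half cubes other than `s i` and `s j` has neither value `v i` nor `v j`, so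
    -- these agree.
    obtain ⟨u, w, hi, hj⟩ := exists_ne_of_two_free_bits
      (fun u w t => if t = k then u else if t = l then w else b t) (k := k) (l := l)
      (by simp) (by simp [hkl.symm]) (s i) (s j)
    have hi' := mt (hs i _ (by simp [hki.symm, hli.symm])).1 hi
    have hj' := mt (hs j _ (by simp [hkj.symm, hlj.symm])).1 hj
    generalize f _ = z at hi' hj'
    generalize v i = vi at *
    generalize v j = vj at *
    cases z <;> cases vi <;> cases vj <;> simp_all
  obtain ⟨V, hV⟩ : ∃ V, ∀ i, v i = V := ⟨v 0, fun i => hv i 0⟩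
  simp only [hV] at hs
  have hsV : ∀ i, f (s i) = V := fun i => (hs i _ (hb i)).2 rfl
  have hpair : ∀ i j, i ≠ j → ∃ (c : Bool) (p : Fin (m + 1) → Bool),
      xor (p i) (p j) = c ∧ ∀ x, xor (x i) (x j) = c → (f x = V ↔ x = p) := by
    intro i j hij
    obtain ⟨c, p, w, hp, hw⟩ := htwo i j hij
    suffices hwV : w = V from ⟨c, p, hp, hwV ▸ hw⟩
    by_contra hwV
    obtain ⟨k, l, hkl, hki, hkj, hli, hlj⟩ := hfree i j
    obtain ⟨u, r, hup, hus⟩ := exists_ne_of_two_free_bits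
      (fun u r t => if t = i then u else if t = j then xor u c else if t = l then r else b t)
      (k := i) (l := l) (by simp) (by simp [hli, hlj]) p (s k)
    have hp' := mt (hw _ (by simp [hij.symm])).1 hup
    have hs' := mt (hs k _ (by simp [hki, hkj, hkl])).1 hus
    generalize f _ = z at hp' hs'
    cases z <;> cases w <;> cases V <;> simp_all
  have hinj : ∀ i j, i ≠ j → s i ≠ s j := by
    intro i j hij hsij
    obtain ⟨c, p, hpc, hp⟩ := hpair i j hij
    -- If `s i = s j`, every point of value `V` lies in one parity class of bits `i` and `j`. It
    -- must be class `c`, where `V` occurs once, so `f` is of AND type.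
    have hiff : ∀ x, f x = V → (x i = b i ↔ x j = b j) := by
      intro x hx
      constructor
      · intro h
        rw [(hs i x h).1 hx, hsij, hb j]
      · intro h
        rw [(hs j x h).1 hx, ← hsij, hb i]
    have hclass : ∀ x, f x = V → xor (x i) (x j) = xor (b i) (b j) := by
      intro x hx
      have := hiff x hx
      revert this
      cases x i <;> cases x j <;> cases b i <;> cases b j <;> simp
    have hc : c = xor (b i) (b j) := by
      rw [← hpc]
      exact hclass p ((hp p hpc).2 rfl)
    refine hf ⟨p, V, fun x => ⟨fun hx => (hp x (by rw [hc, hclass x hx])).1 hx, ?_⟩⟩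
    rintro rfl
    exact (hp x hpc).2 rfl
  have hflip : ∀ i j, i ≠ j → s i j = !b j := by
    intro i j hij
    have : s i j ≠ b j := fun h => hinj i j hij ((hs j _ h).1 (hsV i))
    revert this
    cases s i j <;> cases b j <;> simp
  obtain ⟨i, j, hij, -⟩ := hfree 0 0
  obtain ⟨k, l, hkl, hki, hkj, hli, hlj⟩ := hfree i j
  obtain ⟨c, p, -, hp⟩ := hpair i j hij
  -- The class of `xor (b i) (b j)` contains `s k` and `s l`; the other one contains `s i` and `s
  -- j`.
  by_cases hc : c = xor (b i) (b j)
  · have hmem : ∀ t, t ≠ i → t ≠ j → s t = p := by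
      intro t hti htj
      refine (hp _ ?_).1 (hsV t)
      rw [hflip t i hti, hflip t j htj, hc]
      cases b i <;> cases b j <;> rfl
    exact hinj k l hkl ((hmem k hki hkj).trans (hmem l hli hlj).symm)
  · have hc' : c = !(xor (b i) (b j)) := by
      revert hc
      cases c <;> cases b i <;> cases b j <;> simp
    have h1 : s i = p := by
      refine (hp _ ?_).1 (hsV i)
      rw [hb i, hflip i j hij, hc']
      cases b i <;> cases b j <;> rfl
    have h2 : s j = p := by
      refine (hp _ ?_).1 (hsV j)
      rw [hb j, hflip j i hij.symm, hc']
      cases b i <;> cases b j <;> rfl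
    exact hinj i j hij (h1.trans h2.symm)

/-! ### The main theorem -/

theorem gramSolvable_of_not_isAndType :
    ∀ {m : ℕ} {f : BoolFun (m + 1)}, ¬IsAndType f → GramSolvable f m (onesGram (m + 1))
  | 0, f, hf => by
    -- A nonconstant function of one bit is of AND type.
    refine GramSolvable.of_const (fun x y => ?_) _
    by_contra hxy
    refine hf ⟨x, f x, fun z => ⟨fun hz => ?_, fun hz => by rw [hz]⟩⟩
    have hxy0 : x 0 ≠ y 0 := fun h => hxy (congrArg f (funext fun i => by
      rw [Fin.fin_one_eq_zero i, h]))
    have hzy0 : z 0 ≠ y 0 := fun h => hxy (hz.symm.trans (congrArg f (funext fun i => by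
      rw [Fin.fin_one_eq_zero i, h])))
    funext i
    rw [Fin.fin_one_eq_zero i]
    revert hxy0 hzy0
    cases x 0 <;> cases y 0 <;> cases z 0 <;> simp
  | 1, _, hf => gramSolvable_of_parity₂ (parity₂_of_not_isAndType hf)
  | 2, _, hf => gramSolvable_three hf
  | _ + 3, _, hf => by
    obtain ⟨i, o, h⟩ := exists_restrict_not_isAndType (by omega) hf
    exact GramSolvable.of_restrict i o fun c => gramSolvable_of_not_isAndType (h c)

theorem GramSolvable.exactQuantumQueryComplexity_le {n t : ℕ} {f : BoolFun n}
    (h : GramSolvable f t (onesGram n)) : exactQuantumQueryComplexity f ≤ t := by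
  obtain ⟨A, rfl, hA⟩ := h.exists_algorithm
  exact iInf₂_le A hA

theorem theorem7 (n : ℕ) (f : BoolFun n) :
    exactQuantumQueryComplexity f = (n : ℕ∞) ↔ QueryIsomorphic f (andFun n) := by
  rw [queryIsomorphic_andFun_iff]
  constructor
  · intro h
    by_contra hf
    cases n with
    | zero =>
      exact hf ⟨default, f default, fun x => by simp [Subsingleton.elim x default]⟩
    | succ m =>
      have hle := (gramSolvable_of_not_isAndType hf).exactQuantumQueryComplexity_le
      rw [h, Nat.cast_le] at hle
      omega
  · rintro ⟨p, v, hp⟩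
    refine le_antisymm (gramSolvable_of_bits f).exactQuantumQueryComplexity_le ?_
    refine le_iInf₂ fun A hA => Nat.cast_le.2 (A.le_queries_of_unique_value hA p fun x hx hxp => ?_)
    exact hx ((hp x).1 (hxp.trans ((hp p).2 rfl)))
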